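/- Let $\mathbb{T}^2=[0,1)^2$ be the two-dimensional torus, and let $\hat f(k)=\int_{\mathbb{T}^2}e^{-\mathrm{i}k\cdot x}f(x)\,\mathrm{d}x$, $k\in(2\pi\mathbb{Z})^2$, denote Fourier coefficients, extended to periodic Schwartz distributions; $|\partial_1|^{s}$ is the Fourier multiplier $|k_1|^s$, acting on distributions without modes $k_1=0$. Let $P$ be the projection onto zero average in $x_1$ (removing all modes with $k_1=0$) and $\mathcal{L}=-\partial_1^2-|\partial_1|^{-1}\partial_2^2$. For a periodic distribution $\xi$ and $u\in L^2(\mathbb{T}^2)$ real-valued with zero average in $x_1$ consider $$E_{tot}(u)=\int_{\mathbb{T}^2}(\partial_1u)^2\,\mathrm{d}x+\int_{\mathbb{T}^2}\Big(|\partial_1|^{-\frac12}\big(\partial_2u-\partial_1\tfrac12u^2\big)\Big)^2\mathrm{d}x-2\int_{\mathbb{T}^2}\xi u\,\mathrm{d}x ,$$ understood by Parseval as the unconditional sum, in $[-\infty,\infty]$, over all $k\in(2\pi\mathbb{Z})^2$ of the contributions of the Fourier modes $$e_k(u)=|k_1\hat u(k)|^2+\Big||k_1|^{-\frac12}\big(k_2\hat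 u(k)-k_1\widehat{\tfrac12u^2}(k)\big)\Big|^2-2\,\mathrm{Re}\big(\hat\xi(k)\overline{\hat u(k)}\big)$$ (the second term is $0$ for $k_1=0$); thus $E_{tot}(u)=-\infty$ means that $\sum_k\max(e_k(u),0)<\infty$ and $\sum_k\max(-e_k(u),0)=\infty$. Let also $$\mathcal{H}(u)=\int_{\mathbb{T}^2}(\partial_1u)^2\,\mathrm{d}x+\int_{\mathbb{T}^2}(|\partial_1|^{-\frac12}\partial_2u)^2\,\mathrm{d}x\in[0,\infty]$$ be the harmonic energy, the integrals being read by Parseval as well. **Proposition.** Let $\xi$ be distributed according to the law of white noise on $\mathbb{T}^2$, i.e. $\xi$ is a random real periodic Schwartz distribution such that $\xi(\varphi)$ is a centred Gaussian with variance $\int_{\mathbb{T}^2}\varphi^2\,\mathrm{d}x$ for every $\varphi\in C^\infty(\mathbb{T}^2)$. Then, almost surely, the equation $\mathcal{L}v=P\xi$ has exactly one solution $v\in L^2(\mathbb{T}^2)$ with vanishing average in $x_1$, and for this $v$: 1. $\displaystyle\mathcal{H}(v)=\sum_{k\in(2\pi\mathbb{Z})^2,\,k_1\ne0}\frac{|\hat\xi(k)|^2}{k_1^2+|k_1|^{-1}k_2^2}=+\infty$;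 2. the quartic term is finite: $\displaystyle\int_{\mathbb{T}^2}\Big(|\partial_1|^{-\frac12}\partial_1\tfrac12v^2\Big)^2\mathrm{d}x<\infty$; 3. $E_{tot}(v)=-\infty$. -/

import Mathlib

open MeasureTheory

noncomputable section

namespace Ripple

/-- The two-dimensional torus `𝕋² = (ℝ/ℤ)²`; the coordinate `x₁` has index `0`, `x₂` index `1`. -/
abbrev Torus : Type := UnitAddTorus (Fin 2)

/-- Lebesgue measure on `𝕋²` (total mass one). -/
def torusMeasure : Measure Torus :=
  Measure.pi fun _ : Fin 2 => (AddCircle.haarAddCircle : Measure UnitAddCircle)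

/-- The `ℤ²`-periodic function on `ℝ²` corresponding to a function on the torus. -/
def periodicLift (f : Torus → ℝ) : (Fin 2 → ℝ) → ℝ :=
  fun x => f fun i => (x i : UnitAddCircle)

/-- The space `C^∞(𝕋²)` of real-valued smooth periodic functions. -/
def testFunctions : Submodule ℝ (Torus → ℝ) where
  carrier := {f | ContDiff ℝ ((⊤ : ℕ∞) : WithTop ℕ∞) (periodicLift f)}
  add_mem' := by
    intro f g hf hg
    rw [Set.mem_ofPred_eq] at hf hg ⊢
    exact hf.add hg
  zero_mem' := by
    rw [Set.mem_ofPred_eq]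
    exact contDiff_const
  smul_mem' := by
    intro c f hf
    rw [Set.mem_ofPred_eq] at hf ⊢
    exact contDiff_const.smul hf

/-- Periodic Schwartz distributions: the real linear functionals on `C^∞(𝕋²)` that are continuous
for the Fréchet topology given by the suprema of the derivatives of all orders, that is, those that
are bounded by a multiple of the maximum of finitely many of these suprema. -/
structure PeriodicDistribution where
  /-- the underlying linear functional -/
  toLinearMap : testFunctions →ₗ[ℝ] ℝ
  continuous' : ∃ (N : ℕ) (C : ℝ), ∀ (φ : testFunctions) (B : ℝ),
    (∀ j ≤ N, ∀ x : Fin 2 → ℝ, ‖iteratedFDeriv ℝ j (periodicLift φ) x‖ ≤ B) →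
      |toLinearMap φ| ≤ C * B

instance : CoeFun PeriodicDistribution fun _ => testFunctions → ℝ :=
  ⟨fun ξ => ξ.toLinearMap⟩

/-- The σ-algebra on the space of periodic distributions generated by the evaluations
`ξ ↦ ξ(φ)`, `φ ∈ C^∞(𝕋²)`. -/
instance : MeasurableSpace PeriodicDistribution :=
  ⨆ φ : testFunctions, MeasurableSpace.comap (fun ξ : PeriodicDistribution => ξ φ) inferInstance

/-- `μ` is the law of (periodic) white noise: under `μ`, every `ξ(φ)` is a centred Gaussian with
variance `∫ φ² dx`. By linearity of `ξ` this fixes all finite-dimensional distributions. -/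
def IsWhiteNoise (μ : Measure PeriodicDistribution) : Prop :=
  ∀ φ : testFunctions, μ.map (fun ξ : PeriodicDistribution => ξ φ) =
    ProbabilityTheory.gaussianReal 0
      (Real.toNNReal (∫ x, (φ : Torus → ℝ) x ^ 2 ∂torusMeasure))

lemma contDiff_mFourier (n : Fin 2 → ℤ) :
    ContDiff ℝ ((⊤ : ℕ∞) : WithTop ℕ∞)
      (fun x : Fin 2 → ℝ => UnitAddTorus.mFourier n fun i => (x i : UnitAddCircle)) := by
  simp only [UnitAddTorus.mFourier, ContinuousMap.coe_mk, fourier_coe_apply]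
  refine contDiff_prod fun i _ => Complex.contDiff_exp.comp ?_
  refine (contDiff_const.mul (Complex.ofRealCLM.contDiff.comp (contDiff_apply ℝ ℝ i))).div_const _

/-- The test function `x ↦ cos (2π n·x)`. -/
def cosTest (n : Fin 2 → ℤ) : testFunctions :=
  ⟨fun x => (UnitAddTorus.mFourier n x).re, Complex.reCLM.contDiff.comp (contDiff_mFourier n)⟩

/-- The test function `x ↦ sin (2π n·x)`. -/
def sinTest (n : Fin 2 → ℤ) : testFunctions :=
  ⟨fun x => (UnitAddTorus.mFourier n x).im, Complex.imCLM.contDiff.comp (contDiff_mFourier n)⟩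

/-- The wave number `k_{i+1} = 2π n_i`, where `n ∈ ℤ²` indexes `k ∈ (2πℤ)²`. -/
def wave (n : Fin 2 → ℤ) (i : Fin 2) : ℝ := 2 * Real.pi * n i

/-- Fourier coefficient `ξ̂(k) = ξ(e^{-ik·x})` of a periodic distribution, `k = 2πn`. -/
def PeriodicDistribution.coeff (ξ : PeriodicDistribution) (n : Fin 2 → ℤ) : ℂ :=
  (ξ (cosTest n) : ℂ) - Complex.I * (ξ (sinTest n) : ℂ)

/-- Fourier coefficient `û(k) = ∫ e^{-ik·x} u(x) dx`, `k = 2πn`, of a real function on the torus. -/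
def coeff (u : Torus → ℝ) (n : Fin 2 → ℤ) : ℂ :=
  UnitAddTorus.mFourierCoeff (fun x => (u x : ℂ)) n

/-- The symbol `k₁² + |k₁|⁻¹ k₂²` of `𝓛 = -∂₁² - |∂₁|⁻¹ ∂₂²` (used only where `k₁ ≠ 0`). -/
def symbolL (n : Fin 2 → ℤ) : ℝ :=
  wave n 0 ^ 2 + |wave n 0|⁻¹ * wave n 1 ^ 2

/-- `v` has vanishing average in `x₁` and solves `𝓛 v = P ξ`, where `P` is the projection onto
functions of vanishing average in `x₁`. On Fourier coefficients: vanishing average means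
`v̂(0, k₂) = 0`, and since both sides of the equation have no modes with `k₁ = 0`, the equation
amounts to the identity of the coefficients at all `k` with `k₁ ≠ 0`. -/
structure IsLinearSolution (ξ : PeriodicDistribution) (v : Torus → ℝ) : Prop where
  zero_average : ∀ n : Fin 2 → ℤ, n 0 = 0 → coeff v n = 0
  equation : ∀ n : Fin 2 → ℤ, n 0 ≠ 0 → (symbolL n : ℂ) * coeff v n = ξ.coeff n

/-- Fourier coefficients of `∂₁ u`. -/
def coeffD1 (u : Torus → ℝ) (n : Fin 2 → ℤ) : ℂ := Complex.I * wave n 0 * coeff u n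

/-- Fourier coefficients of `∂₂ u`. -/
def coeffD2 (u : Torus → ℝ) (n : Fin 2 → ℤ) : ℂ := Complex.I * wave n 1 * coeff u n

/-- Multiplier `|k₁|^{-1/2}` of `|∂₁|^{-1/2}` (it only ever acts on distributions without modes
`k₁ = 0`, and has the value `0` there). -/
def halfInv (n : Fin 2 → ℤ) : ℂ := ((|wave n 0| ^ (-(1 / 2) : ℝ) : ℝ) : ℂ)

/-- The function `u²/2`. -/
def halfSq (u : Torus → ℝ) : Torus → ℝ := fun x => u x ^ 2 / 2

/-- Harmonic energy `𝓗(u) = ∫ (∂₁u)² dx + ∫ (|∂₁|^{-1/2} ∂₂u)² dx ∈ [0, ∞]`; the integral of the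
square of a distribution is the (possibly infinite) squared `ℓ²`-norm of its Fourier coefficients. -/
def harmonicEnergy (u : Torus → ℝ) : ENNReal :=
  (∑' n : Fin 2 → ℤ, ENNReal.ofReal (‖coeffD1 u n‖ ^ 2)) +
    ∑' n : Fin 2 → ℤ, ENNReal.ofReal (‖halfInv n * coeffD2 u n‖ ^ 2)

/-- The quartic term `∫ (|∂₁|^{-1/2} ∂₁ (u²/2))² dx ∈ [0, ∞]`. -/
def quarticEnergy (u : Torus → ℝ) : ENNReal :=
  ∑' n : Fin 2 → ℤ, ENNReal.ofReal (‖halfInv n * coeffD1 (halfSq u) n‖ ^ 2)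

/-- The contribution of the Fourier mode `k = 2πn` to the total energy of `u` with noise `ξ`,
`|(∂₁u)^(k)|² + |(|∂₁|^{-1/2} (∂₂u - ∂₁ u²/2))^(k)|² - 2 Re (ξ̂(k) conj û(k))`. -/
def totalEnergyMode (ξ : PeriodicDistribution) (u : Torus → ℝ) (n : Fin 2 → ℤ) : ℝ :=
  ‖coeffD1 u n‖ ^ 2 + ‖halfInv n * (coeffD2 u n - coeffD1 (halfSq u) n)‖ ^ 2
    - 2 * (ξ.coeff n * (starRingEnd ℂ) (coeff u n)).re

/-- Total energy
`E_tot(u) = ∫ (∂₁u)² dx + ∫ (|∂₁|^{-1/2} (∂₂u - ∂₁ u²/2))² dx - 2 ∫ ξ u dx`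
for `u` with vanishing average in `x₁`, as an extended real number: by Parseval, the sum over all
Fourier modes of the energy per mode. The sum is unconditional (limit in `[-∞, ∞]` along all finite
sets of modes), so the value is `-∞` exactly if the sum of the positive parts of the contributions
is finite and the sum of the negative parts is infinite. -/
def totalEnergy (ξ : PeriodicDistribution) (u : Torus → ℝ) : EReal :=
  ∑' n : Fin 2 → ℤ, (totalEnergyMode ξ u n : EReal)

end Ripple

end

/-!
The solution of the linear equation is `v̂ = σ⁻¹ ξ̂` with the symbol `σ = k₁² + |k₁|⁻¹ k₂²`, so that
`𝓗(v) = ∑ σ⁻¹ |ξ̂|²`. Its partial sums have the expectations `∑ σ⁻¹`, which diverge, whereas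
their variances stay below `2 ∑ σ⁻² < ∞`; hence `𝓗(v) = ∞` by Chebyshev's inequality.

The quartic term has finite expectation: by Isserlis' theorem (and Fatou's lemma for the infinite
sums) the modes `k₁ ≠ 0` satisfy `𝔼 |(v²)^(k)|² ≤ 2 ∑ₘ σ(m)⁻² σ(k - m)⁻²`, and since `|k₁|` is
subadditive, `∑ₖ |k₁| ∑ₘ σ(m)⁻² σ(k - m)⁻² ≤ 2 (∑ |k₁| σ⁻²) (∑ σ⁻²) < ∞`.

Finally `2 ξ̂ v̂*` is twice the harmonic energy of the mode, so each mode contributes at most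
`3 q - h / 2` to the total energy, where `q` and `h` are its quartic and harmonic energies.
-/

noncomputable section

namespace Ripple

open ProbabilityTheory Filter Topology
open scoped ENNReal NNReal

section Isserlis

variable {𝕜 A : Type*} [CommRing 𝕜] [CommRing A] [Algebra 𝕜 A]

/-- The four-point formula of Isserlis and Wick, for a functional `E` in the role of an
expectation. -/
def IsserlisFormula (E : A →ₗ[𝕜] 𝕜) (x y z w : A) : Prop :=
  E (x * y * z * w) = E (x * y) * E (z * w) + E (x * z) * E (y * w) + E (x * w) * E (y * z)

variable {E : A →ₗ[𝕜] 𝕜}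

lemma IsserlisFormula.rotate {x y z w : A} (h : IsserlisFormula E x y z w) :
    IsserlisFormula E y z w x := by
  rw [IsserlisFormula] at h ⊢
  rw [show y * z * w * x = x * y * z * w by ring, h, mul_comm z x, mul_comm w x, mul_comm y x]
  ring

lemma IsserlisFormula.of_mem_span {s : Set A} {x y z w : A}
    (h : ∀ x ∈ s, IsserlisFormula E x y z w) (hx : x ∈ Submodule.span 𝕜 s) :
    IsserlisFormula E x y z w := by
  induction hx using Submodule.span_induction with
  | mem x hx => exact h x hx
  | zero => simp [IsserlisFormula]
  | add x x' _ _ hx hx' =>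
    simp only [IsserlisFormula, add_mul, map_add] at hx hx' ⊢
    linear_combination hx + hx'
  | smul c x _ hx =>
    simp only [IsserlisFormula, smul_mul_assoc, map_smul, smul_eq_mul] at hx ⊢
    linear_combination c * hx

lemma isserlisFormula_span {s : Set A}
    (h : ∀ x ∈ s, ∀ y ∈ s, ∀ z ∈ s, ∀ w ∈ s, IsserlisFormula E x y z w) {x y z w : A}
    (hx : x ∈ Submodule.span 𝕜 s) (hy : y ∈ Submodule.span 𝕜 s)
    (hz : z ∈ Submodule.span 𝕜 s) (hw : w ∈ Submodule.span 𝕜 s) :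
    IsserlisFormula E x y z w :=
  .of_mem_span (hx := hx) fun x hx => .rotate <|
    .of_mem_span (hx := hw) fun w hw => .rotate <|
      .of_mem_span (hx := hz) fun z hz => .rotate <|
        .of_mem_span (hx := hy) fun y hy => .rotate <| h x hx y hy z hz w hw

end Isserlis

section Polarization

variable {𝕜 A : Type*} [Field 𝕜] [CommRing A] [Algebra 𝕜 A]

lemma map_mul_eq_of_map_sq_eq [NeZero (2 : 𝕜)] {B M : Type*} [CommRing B] [Algebra 𝕜 B]
    [AddZeroClass M] {E : A →ₗ[𝕜] 𝕜} {E' : B →ₗ[𝕜] 𝕜} {f : M →+ A} {g : M →+ B}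
    (h : ∀ x, E (f x ^ 2) = E' (g x ^ 2)) (x y : M) : E (f x * f y) = E' (g x * g y) := by
  have hxy := h (x + y)
  simp only [map_add, add_sq, two_mul, add_mul, h] at hxy
  refine mul_left_cancel₀ (two_ne_zero (α := 𝕜)) ?_
  linear_combination hxy

variable [CharZero 𝕜] {E : A →ₗ[𝕜] 𝕜} {H : AddSubgroup A}
  (hE : ∀ x ∈ H, E (x ^ 4) = 3 * E (x ^ 2) ^ 2)
include hE

lemma map_sq_mul_sq_of_map_pow_four {x y : A} (hx : x ∈ H) (hy : y ∈ H) :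
    E (x ^ 2 * y ^ 2) = E (x ^ 2) * E (y ^ 2) + 2 * E (x * y) ^ 2 := by
  have sum_pow_four : E ((x + y) ^ 4) + E ((x - y) ^ 4) =
      2 * E (x ^ 4) + 2 * E (y ^ 4) + 12 * E (x ^ 2 * y ^ 2) := by
    have := congrArg E (show (x + y) ^ 4 + (x - y) ^ 4 =
      2 • x ^ 4 + 2 • y ^ 4 + 12 • (x ^ 2 * y ^ 2) by simp only [nsmul_eq_mul]; push_cast; ring)
    simp only [map_add, map_nsmul] at this
    simpa only [nsmul_eq_mul, Nat.cast_ofNat] using this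
  have sq_add : E ((x + y) ^ 2) = E (x ^ 2) + 2 * E (x * y) + E (y ^ 2) := by
    rw [show (x + y) ^ 2 = x ^ 2 + (x * y + x * y) + y ^ 2 by ring, map_add, map_add, map_add,
      two_mul]
  have sq_sub : E ((x - y) ^ 2) = E (x ^ 2) - 2 * E (x * y) + E (y ^ 2) := by
    rw [show (x - y) ^ 2 = x ^ 2 - (x * y + x * y) + y ^ 2 by ring, map_add, map_sub, map_add,
      two_mul]
  rw [hE _ (add_mem hx hy), hE _ (sub_mem hx hy), hE x hx, hE y hy, sq_add, sq_sub]
    at sum_pow_four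
  linear_combination (-1 / 12) * sum_pow_four

lemma map_sq_mul_mul_of_map_pow_four {x y z : A} (hx : x ∈ H) (hy : y ∈ H) (hz : z ∈ H) :
    E (x ^ 2 * (y * z)) = E (x ^ 2) * E (y * z) + 2 * (E (x * y) * E (x * z)) := by
  have h := map_sq_mul_sq_of_map_pow_four hE hx (add_mem hy hz)
  simp only [show (y + z) ^ 2 = y ^ 2 + (y * z + y * z) + z ^ 2 by ring, mul_add, map_add,
    map_sq_mul_sq_of_map_pow_four hE hx hy, map_sq_mul_sq_of_map_pow_four hE hx hz] at h
  linear_combination (1 / 2) * h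

lemma isserlisFormula_of_map_pow_four {x y z w : A} (hx : x ∈ H) (hy : y ∈ H) (hz : z ∈ H)
    (hw : w ∈ H) : IsserlisFormula E x y z w := by
  have h := map_sq_mul_mul_of_map_pow_four hE (add_mem hx hy) hz hw
  simp only [show (x + y) ^ 2 = x ^ 2 + (x * y + x * y) + y ^ 2 by ring, add_mul, map_add,
    map_sq_mul_mul_of_map_pow_four hE hx hz hw,
    map_sq_mul_mul_of_map_pow_four hE hy hz hw] at h
  rw [IsserlisFormula, mul_assoc (x * y)]
  linear_combination (1 / 2) * h

end Polarization

section MomentAlgebra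

variable {Ω : Type*} [MeasurableSpace Ω]

/-- The star algebra of complex random variables with finite moments of all orders, on which
expectations of polynomial expressions need no integrability conditions. -/
def momentAlgebra (μ : Measure Ω) [IsFiniteMeasure μ] : StarSubalgebra ℂ (Ω → ℂ) where
  carrier := {f | ∀ p : ℝ≥0∞, p ≠ ⊤ → MemLp f p μ}
  add_mem' hf hg p hp := (hf p hp).add (hg p hp)
  mul_mem' hf hg p hp := by
    have h2p : 2 * p ≠ ⊤ := ENNReal.mul_ne_top ENNReal.ofNat_ne_top hp
    have : ENNReal.HolderTriple (2 * p) (2 * p) p :=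
      ⟨by rw [ENNReal.mul_inv (by simp) (by simp), ← add_mul, ENNReal.inv_two_add_inv_two,
        one_mul]⟩
    exact (hg _ h2p).mul (hf _ h2p)
  algebraMap_mem' c _ _ := memLp_const c
  star_mem' hf p hp := (hf p hp).star

variable {μ : Measure Ω} [IsFiniteMeasure μ]

lemma memLp_momentAlgebra (X : momentAlgebra μ) {p : ℝ≥0∞} (hp : p ≠ ⊤) :
    MemLp (X : Ω → ℂ) p μ :=
  X.2 p hp

lemma integrable_momentAlgebra (X : momentAlgebra μ) : Integrable (X : Ω → ℂ) μ :=
  memLp_one_iff_integrable.1 (memLp_momentAlgebra X ENNReal.one_ne_top)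

/-- The expectation, as a linear functional on `momentAlgebra μ`. -/
def expectation (μ : Measure Ω) [IsFiniteMeasure μ] : momentAlgebra μ →ₗ[ℂ] ℂ where
  toFun X := ∫ ω, (X : Ω → ℂ) ω ∂μ
  map_add' X Y := integral_add (integrable_momentAlgebra X) (integrable_momentAlgebra Y)
  map_smul' c X := integral_const_mul c (X : Ω → ℂ)

lemma expectation_mul_star (X : momentAlgebra μ) :
    expectation μ (X * star X) = (∫ ω, ‖(X : Ω → ℂ) ω‖ ^ 2 ∂μ : ℝ) := by
  rw [← integral_complex_ofReal]
  refine integral_congr_ae (.of_forall fun ω => ?_)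
  exact (Complex.mul_conj' _).trans (Complex.ofReal_pow _ 2).symm

lemma memLp_norm_sq_momentAlgebra (X : momentAlgebra μ) {p : ℝ≥0∞} (hp : p ≠ ⊤) :
    MemLp (fun ω => ‖(X : Ω → ℂ) ω‖ ^ 2) p μ := by
  simpa [sq] using (memLp_momentAlgebra (X * X) hp).norm

lemma memLp_sum_conv {G : Type*} [Sub G] (Z : G → momentAlgebra μ) (a : G → ℝ) (k : G)
    (F : Finset G) {p : ℝ≥0∞} (hp : p ≠ ⊤) : MemLp (fun ω => ∑ m ∈ F,
      a m * (Z m : Ω → ℂ) ω * (a (k - m) * (Z (k - m) : Ω → ℂ) ω)) p μ := by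
  convert memLp_momentAlgebra (∑ m ∈ F, ((a m : ℂ) • Z m) * ((a (k - m) : ℂ) • Z (k - m))) hp
  simp only [AddSubmonoidClass.coe_finsetSum, Finset.sum_apply]
  rfl

end MomentAlgebra

section Gaussian

lemma deriv_polynomial_mul_exp_sq (p : Polynomial ℝ) (v : ℝ) :
    deriv (fun t => p.eval t * Real.exp (v * t ^ 2 / 2)) = fun t =>
      (p.derivative + p * (Polynomial.C v * Polynomial.X)).eval t * Real.exp (v * t ^ 2 / 2) := by
  ext t
  have hexp : HasDerivAt (fun t : ℝ => v * t ^ 2 / 2) (v * t) t :=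
    ((((hasDerivAt_id t).pow 2).const_mul v).div_const 2).congr_deriv
      (by simp only [Nat.cast_ofNat, id_eq, Nat.add_one_sub_one, pow_one, mul_one]; ring)
  refine (((p.hasDerivAt t).mul hexp.exp).congr_deriv ?_).deriv
  simp only [Polynomial.eval_add, Polynomial.eval_mul, Polynomial.eval_C, Polynomial.eval_X]
  ring

lemma integral_pow_four_gaussianReal (v : ℝ≥0) :
    ∫ x, x ^ 4 ∂gaussianReal 0 v = 3 * (v : ℝ) ^ 2 := by
  have h := iteratedDeriv_mgf_zero (X := fun x : ℝ => x) (μ := gaussianReal 0 v) (by simp) 4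
  have mgf_eq : mgf (fun x : ℝ => x) (gaussianReal 0 v) =
      fun t => (1 : Polynomial ℝ).eval t * Real.exp (v * t ^ 2 / 2) := by
    simp [mgf_fun_id_gaussianReal]
  simp only [mgf_eq, iteratedDeriv_succ, iteratedDeriv_zero, deriv_polynomial_mul_exp_sq,
    Pi.pow_apply] at h
  rw [← h]
  simp only [Polynomial.derivative_one, Polynomial.derivative_mul, Polynomial.derivative_C,
    Polynomial.derivative_X, Polynomial.derivative_add, Polynomial.eval_add, Polynomial.eval_mul,
    Polynomial.eval_C, Polynomial.eval_X, one_mul, mul_one, zero_mul, mul_zero, zero_add, add_zero,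
    ne_eq, OfNat.ofNat_ne_zero, not_false_eq_true, zero_pow, zero_div, Real.exp_zero]
  ring

end Gaussian

lemma sum_sum_mul_mul_ite_le {ι : Type*} [DecidableEq ι] {σ : ι → ι} (hσ : Function.Involutive σ)
    (a : ι → ℝ) (F : Finset ι) :
    ∑ m ∈ F, ∑ n ∈ F, a m * a n * (if m = σ n then 1 else 0) ≤ ∑ n ∈ F, a n ^ 2 := by
  calc ∑ m ∈ F, ∑ n ∈ F, a m * a n * (if m = σ n then 1 else 0)
      ≤ ∑ m ∈ F, ∑ n ∈ F,
          ((if n = σ m then a m ^ 2 / 2 else 0) + if m = σ n then a n ^ 2 / 2 else 0) := by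
        refine Finset.sum_le_sum fun m _ => Finset.sum_le_sum fun n _ => ?_
        simp only [eq_comm.trans hσ.eq_iff]
        split_ifs <;> linarith [two_mul_le_add_sq (a m) (a n)]
    _ = ∑ m ∈ F, (if σ m ∈ F then a m ^ 2 / 2 else 0) +
          ∑ n ∈ F, (if σ n ∈ F then a n ^ 2 / 2 else 0) := by
        simp only [Finset.sum_add_distrib]
        rw [Finset.sum_comm (f := fun m n => if m = σ n then a n ^ 2 / 2 else 0)]
        simp only [Finset.sum_ite_eq']
    _ ≤ ∑ n ∈ F, a n ^ 2 := by
        rw [← Finset.sum_add_distrib]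
        refine Finset.sum_le_sum fun n _ => ?_
        split_ifs <;> linarith [sq_nonneg (a n)]

section Divergence

variable {Ω ι : Type*} [MeasurableSpace Ω] {μ : Measure Ω}

lemma tendsto_sum_atTop_of_not_summable {f : ι → ℝ} (hf : ∀ i, 0 ≤ f i) (h : ¬ Summable f) :
    Tendsto (fun F : Finset ι => ∑ i ∈ F, f i) atTop atTop := by
  refine tendsto_atTop_atTop_of_monotone (Finset.sum_mono_set_of_nonneg hf) fun b => ?_
  by_contra! hb
  exact h (summable_of_sum_le hf fun F => (hb F).le)

/-- Chebyshev's inequality: the partial sums have diverging expectations but bounded variances. -/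
lemma ae_tsum_eq_top_of_variance_le [IsFiniteMeasure μ] {X : ι → Ω → ℝ}
    (hX : ∀ i ω, 0 ≤ X i ω) (hL2 : ∀ i, MemLp (X i) 2 μ) {V : ℝ}
    (hV : ∀ F : Finset ι, Var[fun ω => ∑ i ∈ F, X i ω; μ] ≤ V)
    (hE : ¬ Summable fun i => ∫ ω, X i ω ∂μ) :
    ∀ᵐ ω ∂μ, ∑' i, ENNReal.ofReal (X i ω) = ⊤ := by
  have ae_natCast_le (M : ℕ) : ∀ᵐ ω ∂μ, (M : ℝ≥0∞) ≤ ∑' i, ENNReal.ofReal (X i ω) := by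
    have mean_atTop := tendsto_sum_atTop_of_not_summable (fun i => integral_nonneg (hX i)) hE
    have bound_zero : Tendsto (fun F : Finset ι =>
        ENNReal.ofReal (V / (∑ i ∈ F, ∫ ω, X i ω ∂μ - M) ^ 2)) atTop (𝓝 0) := by
      rw [← ENNReal.ofReal_zero]
      exact ENNReal.tendsto_ofReal (((tendsto_pow_atTop two_ne_zero).comp
        (tendsto_atTop_add_const_right _ (-M : ℝ) mean_atTop)).const_div_atTop V)
    refine ae_iff.2 (le_antisymm (ge_of_tendsto bound_zero ?_) zero_le)
    filter_upwards [mean_atTop.eventually_gt_atTop (M : ℝ)] with F hF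
    have mean_eq : ∫ ω, ∑ i ∈ F, X i ω ∂μ = ∑ i ∈ F, ∫ ω, X i ω ∂μ :=
      integral_finsetSum _ fun i _ => (hL2 i).integrable one_le_two
    have chebyshev := meas_ge_le_variance_div_sq (memLp_finsetSum F fun i _ => hL2 i)
      (sub_pos.2 hF)
    rw [mean_eq] at chebyshev
    refine (measure_mono fun ω hω => ?_).trans
      (chebyshev.trans (ENNReal.ofReal_le_ofReal (by gcongr; exact hV F)))
    have partial_lt : ENNReal.ofReal (∑ i ∈ F, X i ω) < M := by
      rw [ENNReal.ofReal_sum_of_nonneg fun i _ => hX i ω]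
      exact (ENNReal.sum_le_tsum F).trans_lt (not_le.1 hω)
    rw [← ENNReal.ofReal_natCast, ENNReal.ofReal_lt_ofReal_iff_of_nonneg
      (Finset.sum_nonneg fun i _ => hX i ω)] at partial_lt
    rw [Set.mem_ofPred_eq, abs_sub_comm]
    exact (sub_le_sub_left partial_lt.le _).trans (le_abs_self _)
  filter_upwards [ae_all_iff.2 ae_natCast_le] with ω hω
  exact ENNReal.eq_top_of_forall_nnreal_le fun r =>
    (ENNReal.coe_le_coe.2 (Nat.le_ceil r)).trans (hω ⌈r⌉₊)

variable [Countable ι]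

lemma ae_summable_of_summable_integral {X : ι → Ω → ℝ}
    (hX : ∀ i ω, 0 ≤ X i ω) (hXint : ∀ i, Integrable (X i) μ)
    (hs : Summable fun i => ∫ ω, X i ω ∂μ) : ∀ᵐ ω ∂μ, Summable fun i => X i ω := by
  have hm (i) : AEMeasurable (fun ω => ENNReal.ofReal (X i ω)) μ :=
    (hXint i).aemeasurable.ennreal_ofReal
  have hfin : ∫⁻ ω, ∑' i, ENNReal.ofReal (X i ω) ∂μ ≠ ⊤ := by
    simp only [lintegral_tsum hm,
      ← ofReal_integral_eq_lintegral_ofReal (hXint _) (.of_forall (hX _))]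
    exact hs.tsum_ofReal_ne_top
  filter_upwards [ae_lt_top' (.tsum hm) hfin] with ω hω
  exact (ENNReal.summable_toReal hω.ne).congr fun i => (ENNReal.toReal_ofReal (hX i ω)).symm ▸ rfl

lemma lintegral_enorm_tsum_sq_le {E : Type*} [NormedAddCommGroup E] {f : ι → Ω → E}
    (hf : ∀ i, AEStronglyMeasurable (f i) μ) (hs : ∀ᵐ ω ∂μ, Summable fun i => f i ω) {C : ℝ≥0∞}
    (hC : ∀ F : Finset ι, ∫⁻ ω, ‖∑ i ∈ F, f i ω‖ₑ ^ 2 ∂μ ≤ C) :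
    ∫⁻ ω, ‖∑' i, f i ω‖ₑ ^ 2 ∂μ ≤ C := by
  calc ∫⁻ ω, ‖∑' i, f i ω‖ₑ ^ 2 ∂μ
      = ∫⁻ ω, liminf (fun F : Finset ι => ‖∑ i ∈ F, f i ω‖ₑ ^ 2) atTop ∂μ := by
        refine lintegral_congr_ae ?_
        filter_upwards [hs] with ω hω
        exact (((ENNReal.continuous_pow 2).tendsto _).comp hω.hasSum.enorm).liminf_eq.symm
    _ ≤ liminf (fun F : Finset ι => ∫⁻ ω, ‖∑ i ∈ F, f i ω‖ₑ ^ 2 ∂μ) atTop :=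
        lintegral_liminf_le' fun F =>
          (Finset.aestronglyMeasurable_fun_sum F fun i _ => hf i).enorm.pow_const 2
    _ ≤ C := liminf_le_of_le (by isBoundedDefault) fun b hb =>
        hb.exists.elim fun F hF => hF.trans (hC F)

end Divergence

section WhiteNoiseMoments

variable {G Ω : Type*} [AddCommGroup G] [DecidableEq G] [MeasurableSpace Ω] {μ : Measure Ω}
  [IsProbabilityMeasure μ]

/-- The random variables `Z n`, indexed by a group of frequencies, have the symmetry and the second
and fourth moments of the Fourier coefficients of a real white noise. -/
structure HasWhiteNoiseMoments (Z : G → momentAlgebra μ) : Prop where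
  star_eq : ∀ n, star (Z n) = Z (-n)
  expectation_mul : ∀ m n, expectation μ (Z m * Z n) = if m + n = 0 then 1 else 0
  isserlis : ∀ a b c d, IsserlisFormula (expectation μ) (Z a) (Z b) (Z c) (Z d)

namespace HasWhiteNoiseMoments

variable {Z : G → momentAlgebra μ} (hZ : HasWhiteNoiseMoments Z)
include hZ

lemma expectation_mul_mul_star (a b c d : G) :
    expectation μ (Z a * Z b * star (Z c * Z d)) =
      (if a + b = 0 then 1 else 0) * (if c + d = 0 then 1 else 0) +
      (if a = c then 1 else 0) * (if b = d then 1 else 0) +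
      (if a = d then 1 else 0) * (if b = c then 1 else 0) := by
  rw [star_mul', hZ.star_eq, hZ.star_eq, ← mul_assoc, hZ.isserlis]
  simp only [hZ.expectation_mul, ← neg_add, neg_eq_zero, add_neg_eq_zero]

lemma integral_norm_sq (n : G) : ∫ ω, ‖(Z n : Ω → ℂ) ω‖ ^ 2 ∂μ = 1 := by
  have h := expectation_mul_star (Z n)
  rw [hZ.star_eq, hZ.expectation_mul, add_neg_cancel, if_pos rfl] at h
  exact_mod_cast h.symm

lemma covariance_norm_sq (m n : G) :
    cov[fun ω => ‖(Z m : Ω → ℂ) ω‖ ^ 2, fun ω => ‖(Z n : Ω → ℂ) ω‖ ^ 2; μ] =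
      (if m = n then 1 else 0) + if m = -n then 1 else 0 := by
  have fourth_moment : ((∫ ω, ‖(Z m : Ω → ℂ) ω‖ ^ 2 * ‖(Z n : Ω → ℂ) ω‖ ^ 2 ∂μ : ℝ) : ℂ) =
      expectation μ (Z m * Z n * star (Z m * Z n)) := by
    simp only [expectation_mul_star, ← mul_pow, ← norm_mul]
    rfl
  rw [hZ.expectation_mul_mul_star] at fourth_moment
  rw [covariance_eq_sub (memLp_norm_sq_momentAlgebra _ ENNReal.ofNat_ne_top)
    (memLp_norm_sq_momentAlgebra _ ENNReal.ofNat_ne_top)]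
  simp only [Pi.mul_apply, hZ.integral_norm_sq]
  rw [← Complex.ofReal_inj]
  push_cast [fourth_moment]
  simp only [add_eq_zero_iff_eq_neg, eq_comm (a := n)]
  split_ifs <;> simp

lemma variance_sum_mul_norm_sq_le (c : G → ℝ) (F : Finset G) :
    Var[fun ω => ∑ n ∈ F, c n * ‖(Z n : Ω → ℂ) ω‖ ^ 2; μ] ≤ 2 * ∑ n ∈ F, c n ^ 2 := by
  have hL2 (n : G) : MemLp (fun ω => c n * ‖(Z n : Ω → ℂ) ω‖ ^ 2) 2 μ :=
    (memLp_norm_sq_momentAlgebra _ ENNReal.ofNat_ne_top).const_mul (c n)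
  rw [variance_fun_sum' fun n _ => hL2 n]
  simp only [covariance_const_mul_left]
  simp only [covariance_const_mul_right, hZ.covariance_norm_sq, ← mul_assoc, mul_add,
    Finset.sum_add_distrib]
  rw [two_mul]
  exact add_le_add (sum_sum_mul_mul_ite_le (σ := id) (fun _ => rfl) c F)
    (sum_sum_mul_mul_ite_le neg_involutive c F)

lemma integral_norm_sum_sq_le (a : G → ℝ) {k : G} (hk : k ≠ 0) (F : Finset G) :
    ∫ ω, ‖∑ m ∈ F, (a m : ℂ) * ((Z m : Ω → ℂ) ω * (Z (k - m) : Ω → ℂ) ω)‖ ^ 2 ∂μ ≤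
      2 * ∑ m ∈ F, a m ^ 2 := by
  set S : momentAlgebra μ := ∑ m ∈ F, (a m : ℂ) • (Z m * Z (k - m)) with hS
  have expand : expectation μ (S * star S) = ((∑ m ∈ F, ∑ n ∈ F, a m * a n *
      ((if m = n then 1 else 0) + if m = k - n then 1 else 0) : ℝ) : ℂ) := by
    simp only [hS, star_sum, Finset.sum_mul_sum, map_sum, star_smul, smul_mul_smul_comm,
      map_smul, hZ.expectation_mul_mul_star, add_sub_cancel, hk, if_false, zero_mul, zero_add,
      sub_right_inj, smul_eq_mul, Complex.star_def, Complex.conj_ofReal, Complex.ofReal_sum]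
    refine Finset.sum_congr rfl fun m _ => Finset.sum_congr rfl fun n _ => ?_
    have swap : k - m = n ↔ m = k - n := by rw [sub_eq_iff_eq_add, eq_sub_iff_add_eq', eq_comm]
    simp only [swap]
    split_ifs <;> simp
  have integral_eq : ∫ ω, ‖∑ m ∈ F, (a m : ℂ) * ((Z m : Ω → ℂ) ω * (Z (k - m) : Ω → ℂ) ω)‖ ^ 2 ∂μ =
      ∫ ω, ‖(S : Ω → ℂ) ω‖ ^ 2 ∂μ := by
    simp [hS]
  rw [expectation_mul_star, Complex.ofReal_inj] at expand
  rw [integral_eq, expand, two_mul]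
  simp only [mul_add, Finset.sum_add_distrib]
  exact add_le_add (sum_sum_mul_mul_ite_le (σ := id) (fun _ => rfl) a F)
    (sum_sum_mul_mul_ite_le (sub_sub_cancel k) a F)

lemma ae_summable_mul_norm_sq [Countable G] {c : G → ℝ} (hc : ∀ n, 0 ≤ c n) (hs : Summable c) :
    ∀ᵐ ω ∂μ, Summable fun n => c n * ‖(Z n : Ω → ℂ) ω‖ ^ 2 := by
  refine ae_summable_of_summable_integral (fun n ω => mul_nonneg (hc n) (sq_nonneg _))
    (fun n => (memLp_one_iff_integrable.1
      (memLp_norm_sq_momentAlgebra _ ENNReal.one_ne_top)).const_mul (c n)) ?_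
  simpa only [integral_const_mul, hZ.integral_norm_sq, mul_one] using hs

lemma ae_tsum_mul_norm_sq_eq_top {c : G → ℝ} (hc : ∀ n, 0 ≤ c n)
    (hns : ¬ Summable c) (hs : Summable fun n => c n ^ 2) :
    ∀ᵐ ω ∂μ, ∑' n, ENNReal.ofReal (c n * ‖(Z n : Ω → ℂ) ω‖ ^ 2) = ⊤ := by
  refine ae_tsum_eq_top_of_variance_le (fun n ω => mul_nonneg (hc n) (sq_nonneg _))
    (fun n => (memLp_norm_sq_momentAlgebra _ ENNReal.ofNat_ne_top).const_mul (c n))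
    (V := 2 * ∑' n, c n ^ 2) (fun F => (hZ.variance_sum_mul_norm_sq_le c F).trans ?_) ?_
  · gcongr
    exact hs.sum_le_tsum F fun n _ => sq_nonneg _
  · simpa only [integral_const_mul, hZ.integral_norm_sq, mul_one] using hns

variable [Countable G] {a : G → ℝ}

lemma ae_summable_conv (ha : Summable fun n => a n ^ 2) :
    ∀ᵐ ω ∂μ, ∀ k, Summable fun m =>
      a m * (Z m : Ω → ℂ) ω * (a (k - m) * (Z (k - m) : Ω → ℂ) ω) := by
  filter_upwards [hZ.ae_summable_mul_norm_sq (fun n => sq_nonneg (a n)) ha] with ω hω k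
  have shifted := (Equiv.subLeft k).summable_iff.2 hω
  refine .of_norm_bounded (hω.add shifted) fun m => ?_
  simp only [Function.comp_apply, Equiv.subLeft_apply, norm_mul, Complex.norm_real,
    Real.norm_eq_abs]
  rw [← sq_abs (a m), ← sq_abs (a (k - m)), ← mul_pow, ← mul_pow]
  nlinarith [sq_nonneg (|a m| * ‖(Z m : Ω → ℂ) ω‖),
    sq_nonneg (|a (k - m)| * ‖(Z (k - m) : Ω → ℂ) ω‖),
    two_mul_le_add_sq (|a m| * ‖(Z m : Ω → ℂ) ω‖) (|a (k - m)| * ‖(Z (k - m) : Ω → ℂ) ω‖)]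

lemma lintegral_enorm_conv_sq_le (ha : Summable fun n => a n ^ 2) {k : G} (hk : k ≠ 0) :
    ∫⁻ ω, ‖∑' m, a m * (Z m : Ω → ℂ) ω * (a (k - m) * (Z (k - m) : Ω → ℂ) ω)‖ₑ ^ 2 ∂μ ≤
      2 * ∑' m, ENNReal.ofReal ((a m * a (k - m)) ^ 2) := by
  refine lintegral_enorm_tsum_sq_le (fun m => ?_) ((hZ.ae_summable_conv ha).mono fun ω h => h k)
    fun F => ?_
  · simpa using (memLp_sum_conv Z a k {m} ENNReal.one_ne_top).aestronglyMeasurable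
  have integrable_sq :=
    (memLp_sum_conv Z a k F ENNReal.ofNat_ne_top).integrable_norm_pow two_ne_zero
  calc ∫⁻ ω, ‖∑ m ∈ F, a m * (Z m : Ω → ℂ) ω * (a (k - m) * (Z (k - m) : Ω → ℂ) ω)‖ₑ ^ 2 ∂μ
      = ENNReal.ofReal (∫ ω,
          ‖∑ m ∈ F, a m * (Z m : Ω → ℂ) ω * (a (k - m) * (Z (k - m) : Ω → ℂ) ω)‖ ^ 2 ∂μ) := by
        rw [ofReal_integral_eq_lintegral_ofReal integrable_sq (.of_forall fun ω => sq_nonneg _)]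
        simp only [ENNReal.ofReal_pow (norm_nonneg _), ofReal_norm]
    _ ≤ ENNReal.ofReal (2 * ∑ m ∈ F, (a m * a (k - m)) ^ 2) := by
        refine ENNReal.ofReal_le_ofReal ?_
        convert hZ.integral_norm_sum_sq_le (fun m => a m * a (k - m)) hk F using 6
        push_cast
        ring
    _ ≤ 2 * ∑' m, ENNReal.ofReal ((a m * a (k - m)) ^ 2) := by
        rw [ENNReal.ofReal_mul zero_le_two, ENNReal.ofReal_ofNat,
          ENNReal.ofReal_sum_of_nonneg fun _ _ => sq_nonneg _]
        gcongr
        exact ENNReal.sum_le_tsum F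

lemma aemeasurable_enorm_conv (ha : Summable fun n => a n ^ 2) (k : G) :
    AEMeasurable (fun ω =>
      ‖∑' m, a m * (Z m : Ω → ℂ) ω * (a (k - m) * (Z (k - m) : Ω → ℂ) ω)‖ₑ) μ :=
  (aestronglyMeasurable_of_tendsto_ae atTop
    (fun F => (memLp_sum_conv Z a k F ENNReal.one_ne_top).aestronglyMeasurable)
    ((hZ.ae_summable_conv ha).mono fun _ h => (h k).hasSum)).enorm

lemma ae_tsum_mul_enorm_conv_sq_lt_top (ha : Summable fun n => a n ^ 2) {w : G → ℝ≥0∞}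
    (hw0 : w 0 = 0) (hw : ∑' k, w k * ∑' m, ENNReal.ofReal ((a m * a (k - m)) ^ 2) ≠ ⊤) :
    ∀ᵐ ω ∂μ, ∑' k, w k *
      ‖∑' m, a m * (Z m : Ω → ℂ) ω * (a (k - m) * (Z (k - m) : Ω → ℂ) ω)‖ₑ ^ 2 < ⊤ := by
  have measurable_term (k : G) := ((hZ.aemeasurable_enorm_conv ha k).pow_const 2).const_mul (w k)
  refine ae_lt_top' (.tsum measurable_term) (ne_top_of_le_ne_top
    (ENNReal.mul_ne_top (ENNReal.ofNat_ne_top (n := 2)) hw) ?_)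
  rw [lintegral_tsum measurable_term, ← ENNReal.tsum_mul_left]
  refine ENNReal.tsum_le_tsum fun k => ?_
  rw [lintegral_const_mul'' _ ((hZ.aemeasurable_enorm_conv ha k).pow_const 2)]
  obtain rfl | hk := eq_or_ne k 0
  · simp [hw0]
  · rw [mul_left_comm]
    gcongr
    exact hZ.lintegral_enorm_conv_sq_le ha hk

end HasWhiteNoiseMoments

end WhiteNoiseMoments

section TestFunctions

instance : IsProbabilityMeasure torusMeasure := by
  unfold torusMeasure
  infer_instance

lemma continuous_testFunction (φ : testFunctions) : Continuous (φ : Torus → ℝ) := by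
  have quotient_map : IsOpenQuotientMap fun (x : Fin 2 → ℝ) i => (x i : UnitAddCircle) :=
    IsOpenQuotientMap.piMap fun _ => QuotientAddGroup.isOpenQuotientMap_mk
  have smooth : ContDiff ℝ ((⊤ : ℕ∞) : WithTop ℕ∞) (periodicLift φ) := φ.2
  exact quotient_map.isQuotientMap.continuous_iff.2 smooth.continuous

/-- Test functions as complex random variables on the torus. -/
def testMoment : testFunctions →+ momentAlgebra torusMeasure where
  toFun φ := ⟨fun x => (φ : Torus → ℝ) x, fun _ _ =>
    ((continuous_testFunction φ).memLp_of_hasCompactSupport (.of_compactSpace _)).ofReal⟩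
  map_zero' := Subtype.ext <| funext fun _ => Complex.ofReal_zero
  map_add' _ _ := Subtype.ext <| funext fun _ => Complex.ofReal_add _ _

lemma expectation_testMoment_sq (φ : testFunctions) :
    expectation torusMeasure (testMoment φ ^ 2) =
      (∫ x, (φ : Torus → ℝ) x ^ 2 ∂torusMeasure : ℝ) := by
  rw [← integral_complex_ofReal]
  exact integral_congr_ae (.of_forall fun x => (Complex.ofReal_pow _ 2).symm)

lemma testMoment_cos_sub_sin (n : Fin 2 → ℤ) :
    (testMoment (cosTest n) - Complex.I • testMoment (sinTest n) : Torus → ℂ) =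
      UnitAddTorus.mFourier (-n) := by
  ext x
  rw [UnitAddTorus.mFourier_neg]
  apply Complex.ext <;> simp [testMoment, cosTest, sinTest]

lemma integral_mFourier (n : Fin 2 → ℤ) :
    ∫ x, UnitAddTorus.mFourier n x ∂torusMeasure = if n = 0 then 1 else 0 := by
  have h := orthonormal_iff_ite.1 (UnitAddTorus.orthonormal_mFourier (d := Fin 2)) 0 n
  rw [ContinuousMap.inner_toLp] at h
  simp only [UnitAddTorus.mFourier_zero, ContinuousMap.one_apply, map_one, mul_one] at h
  simp only [eq_comm (a := n)]
  exact h

lemma cosTest_neg (n : Fin 2 → ℤ) : cosTest (-n) = cosTest n := by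
  ext x
  simp [cosTest, UnitAddTorus.mFourier_neg]

lemma sinTest_neg (n : Fin 2 → ℤ) : sinTest (-n) = -sinTest n := by
  ext x
  simp [sinTest, UnitAddTorus.mFourier_neg]

lemma PeriodicDistribution.coeff_neg (ξ : PeriodicDistribution) (n : Fin 2 → ℤ) :
    ξ.coeff (-n) = star (ξ.coeff n) := by
  simp [PeriodicDistribution.coeff, cosTest_neg, sinTest_neg]

end TestFunctions

section WhiteNoise

variable {μ : Measure PeriodicDistribution}

lemma measurable_eval (φ : testFunctions) : Measurable (fun ξ : PeriodicDistribution => ξ φ) :=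
  Measurable.of_comap_le (le_iSup (fun φ : testFunctions =>
    MeasurableSpace.comap (fun ξ : PeriodicDistribution => ξ φ) inferInstance) φ)

namespace IsWhiteNoise

variable (hμ : IsWhiteNoise μ)
include hμ

lemma isProbabilityMeasure : IsProbabilityMeasure μ := by
  have h : IsProbabilityMeasure (μ.map fun ξ : PeriodicDistribution => ξ 0) := by
    rw [hμ 0]
    infer_instance
  exact Measure.isProbabilityMeasure_of_map fun ξ : PeriodicDistribution => ξ 0

lemma integral_comp_eval (φ : testFunctions) {g : ℝ → ℝ} (hg : Measurable g) :
    ∫ ξ, g (ξ φ) ∂μ =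
      ∫ x, g x ∂gaussianReal 0 (∫ x, (φ : Torus → ℝ) x ^ 2 ∂torusMeasure).toNNReal := by
  rw [← hμ φ, integral_map (measurable_eval φ).aemeasurable hg.aestronglyMeasurable]

lemma integral_sq (φ : testFunctions) :
    ∫ ξ, ξ φ ^ 2 ∂μ = ∫ x, (φ : Torus → ℝ) x ^ 2 ∂torusMeasure := by
  have h := variance_fun_id_gaussianReal (μ := 0)
    (v := Real.toNNReal (∫ x, (φ : Torus → ℝ) x ^ 2 ∂torusMeasure))
  rw [variance_eq_integral measurable_id'.aemeasurable] at h
  simp only [integral_id_gaussianReal, sub_zero] at h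
  rw [hμ.integral_comp_eval φ (g := (· ^ 2)) (by fun_prop), h,
    Real.coe_toNNReal _ (integral_nonneg fun x => sq_nonneg _)]

lemma integral_pow_four (φ : testFunctions) :
    ∫ ξ, ξ φ ^ 4 ∂μ = 3 * (∫ ξ, ξ φ ^ 2 ∂μ) ^ 2 := by
  rw [hμ.integral_comp_eval φ (g := (· ^ 4)) (by fun_prop), integral_pow_four_gaussianReal,
    Real.coe_toNNReal _ (integral_nonneg fun x => sq_nonneg _), hμ.integral_sq]

variable [IsProbabilityMeasure μ]

/-- The evaluations `ξ ↦ ξ(φ)` as complex random variables. -/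
def evalMoment : testFunctions →+ momentAlgebra μ where
  toFun φ := ⟨fun ξ => ξ φ, fun p hp => by
    have h := memLp_id_gaussianReal' (μ := 0)
      (v := Real.toNNReal (∫ x, (φ : Torus → ℝ) x ^ 2 ∂torusMeasure)) p hp
    rw [← hμ φ] at h
    exact (h.comp_of_map (measurable_eval φ).aemeasurable).ofReal⟩
  map_zero' := Subtype.ext <| funext fun ξ => by simp
  map_add' φ ψ := Subtype.ext <| funext fun ξ => by simp

lemma expectation_evalMoment_pow (φ : testFunctions) (j : ℕ) :
    expectation μ (hμ.evalMoment φ ^ j) = (∫ ξ, ξ φ ^ j ∂μ : ℝ) := by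
  rw [← integral_complex_ofReal]
  exact integral_congr_ae (.of_forall fun ξ => (Complex.ofReal_pow _ j).symm)

lemma expectation_evalMoment_mul (φ ψ : testFunctions) :
    expectation μ (hμ.evalMoment φ * hμ.evalMoment ψ) =
      expectation torusMeasure (testMoment φ * testMoment ψ) :=
  map_mul_eq_of_map_sq_eq (fun φ => by
    rw [expectation_evalMoment_pow, hμ.integral_sq, expectation_testMoment_sq]) φ ψ

/-- The Fourier coefficient `ξ ↦ ξ̂(2πn)` as a complex random variable. -/
def coeffMoment (n : Fin 2 → ℤ) : momentAlgebra μ :=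
  hμ.evalMoment (cosTest n) - Complex.I • hμ.evalMoment (sinTest n)

lemma expectation_coeffMoment_mul (m n : Fin 2 → ℤ) :
    expectation μ (hμ.coeffMoment m * hμ.coeffMoment n) = if m + n = 0 then 1 else 0 := by
  have transfer : expectation μ (hμ.coeffMoment m * hμ.coeffMoment n) = expectation torusMeasure
      ((testMoment (cosTest m) - Complex.I • testMoment (sinTest m)) *
        (testMoment (cosTest n) - Complex.I • testMoment (sinTest n))) := by
    simp only [coeffMoment, sub_mul, mul_sub, smul_mul_assoc, mul_smul_comm, map_sub, map_smul,
      hμ.expectation_evalMoment_mul]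
  simp only [transfer, ← neg_eq_zero (a := m + n)]
  rw [← integral_mFourier, neg_add]
  refine integral_congr_ae (.of_forall fun x => ?_)
  rw [UnitAddTorus.mFourier_add, ← testMoment_cos_sub_sin, ← testMoment_cos_sub_sin]
  rfl

lemma isserlisFormula_coeffMoment (a b c d : Fin 2 → ℤ) :
    IsserlisFormula (expectation μ) (hμ.coeffMoment a) (hμ.coeffMoment b) (hμ.coeffMoment c)
      (hμ.coeffMoment d) := by
  have mem_span (n) : hμ.coeffMoment n ∈ Submodule.span ℂ (hμ.evalMoment.range : Set _) :=
    sub_mem (Submodule.subset_span ⟨_, rfl⟩)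
      (Submodule.smul_mem _ _ (Submodule.subset_span ⟨_, rfl⟩))
  refine isserlisFormula_span (fun x hx y hy z hz w hw => isserlisFormula_of_map_pow_four ?_
    hx hy hz hw) (mem_span a) (mem_span b) (mem_span c) (mem_span d)
  rintro _ ⟨φ, rfl⟩
  rw [expectation_evalMoment_pow, expectation_evalMoment_pow, hμ.integral_pow_four]
  push_cast
  rfl

lemma hasWhiteNoiseMoments : HasWhiteNoiseMoments hμ.coeffMoment where
  star_eq n := Subtype.ext <| funext fun ξ => (ξ.coeff_neg n).symm
  expectation_mul := hμ.expectation_coeffMoment_mul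
  isserlis := hμ.isserlisFormula_coeffMoment

end IsWhiteNoise

end WhiteNoise

section Symbol

lemma symbolL_nonneg (n : Fin 2 → ℤ) : 0 ≤ symbolL n := by
  unfold symbolL
  positivity

lemma symbolL_neg (n : Fin 2 → ℤ) : symbolL (-n) = symbolL n := by
  simp [symbolL, wave]

lemma symbolL_eq_zero {n : Fin 2 → ℤ} (h : n 0 = 0) : symbolL n = 0 := by
  simp [symbolL, wave, h]

lemma symbolL_pos {n : Fin 2 → ℤ} (h : n 0 ≠ 0) : 0 < symbolL n := by
  have : wave n 0 ≠ 0 := by simp [wave, h, Real.pi_ne_zero]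
  unfold symbolL
  positivity

lemma abs_wave (n : Fin 2 → ℤ) (i : Fin 2) : |wave n i| = 2 * Real.pi * |(n i : ℝ)| := by
  rw [wave, abs_mul, abs_of_pos Real.two_pi_pos]

lemma wave_add (m n : Fin 2 → ℤ) (i : Fin 2) : wave (m + n) i = wave m i + wave n i := by
  simp only [wave, Pi.add_apply, Int.cast_add]
  ring

lemma symbolL_eq (n : Fin 2 → ℤ) :
    symbolL n = (2 * Real.pi) ^ 2 * |(n 0 : ℝ)| ^ 2 +
      2 * Real.pi * (|(n 1 : ℝ)| ^ 2 / |(n 0 : ℝ)|) := by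
  have hpi := Real.pi_ne_zero
  rw [symbolL, abs_wave, sq_abs, sq_abs, wave, wave]
  obtain h | h := eq_or_ne (n 0) 0
  · simp [h]
  · have : |(n 0 : ℝ)| ≠ 0 := by simpa using h
    field_simp

lemma symbolL_le {n : Fin 2 → ℤ} (h : |(n 1 : ℝ)| ≤ |(n 0 : ℝ)|) (h0 : n 0 ≠ 0) :
    symbolL n ≤ ((2 * Real.pi) ^ 2 + 2 * Real.pi) * |(n 0 : ℝ)| ^ 2 := by
  have one_le : (1 : ℝ) ≤ |(n 0 : ℝ)| := mod_cast Int.one_le_abs h0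
  rw [symbolL_eq, add_mul]
  gcongr
  calc |(n 1 : ℝ)| ^ 2 / |(n 0 : ℝ)| ≤ |(n 1 : ℝ)| ^ 2 := div_le_self (sq_nonneg _) one_le
    _ ≤ |(n 0 : ℝ)| ^ 2 := by gcongr

lemma not_summable_inv_symbolL : ¬ Summable fun n : Fin 2 → ℤ => (symbolL n)⁻¹ := by
  intro h
  have summable_pair := (finTwoArrowEquiv ℤ).symm.summable_iff.2 h
  set C : ℝ := (2 * Real.pi) ^ 2 + 2 * Real.pi
  have summable_row : Summable fun p : ℕ => ∑' q : ℤ, (symbolL ![p, q])⁻¹ :=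
    summable_pair.prod.comp_injective Nat.cast_injective
  have term_ge (p : ℕ) (q : ℤ) (hq : q ∈ Finset.Ioc 0 (p : ℤ)) :
      (C * (p : ℝ) ^ 2)⁻¹ ≤ (symbolL ![p, q])⁻¹ := by
    obtain ⟨hq0, hqp⟩ := Finset.mem_Ioc.1 hq
    have hp : (![(p : ℤ), q] : Fin 2 → ℤ) 0 ≠ 0 := (hq0.trans_le hqp).ne'
    refine inv_anti₀ (symbolL_pos hp) ((symbolL_le ?_ hp).trans_eq (by simp [C]))
    simpa using abs_le_abs_of_nonneg (Int.cast_nonneg hq0.le) (Int.cast_le (R := ℝ).2 hqp)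
  have row_ge (p : ℕ) : C⁻¹ * (1 / (p : ℝ)) ≤ ∑' q : ℤ, (symbolL ![p, q])⁻¹ :=
    calc C⁻¹ * (1 / (p : ℝ)) = ∑ _ ∈ Finset.Ioc 0 (p : ℤ), (C * (p : ℝ) ^ 2)⁻¹ := by
          rw [Finset.sum_const, Int.card_Ioc, nsmul_eq_mul, sub_zero, Int.toNat_natCast, mul_inv]
          obtain rfl | hp := eq_or_ne p 0
          · simp
          · field_simp
      _ ≤ ∑ q ∈ Finset.Ioc 0 (p : ℤ), (symbolL ![p, q])⁻¹ := Finset.sum_le_sum (term_ge p)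
      _ ≤ _ := (summable_pair.prod_factor (p : ℤ)).sum_le_tsum _
          fun _ _ => inv_nonneg.2 (symbolL_nonneg _)
  have hC : C⁻¹ ≠ 0 := by positivity
  exact Real.not_summable_one_div_natCast ((summable_mul_left_iff hC).1
    (summable_row.of_nonneg_of_le (fun p => by positivity) row_ge))

lemma rpow_mul_rpow_le_add_rpow {x y p q : ℝ} (hx : 0 ≤ x) (hy : 0 ≤ y) (hp : 0 ≤ p)
    (hq : 0 ≤ q) : x ^ p * y ^ q ≤ (x + y) ^ (p + q) := by
  rw [Real.rpow_add_of_nonneg (add_nonneg hx hy) hp hq]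
  gcongr <;> linarith

/-- The powers `7 / 5` of `a ^ 2` and `3 / 5` of `b ^ 2 / a` leave a decay rate above `1` in both
variables. -/
lemma div_sq_add_sq_div_sq_le {a b : ℝ} (ha : 0 < a) (hb : 0 < b) :
    a / (a ^ 2 + b ^ 2 / a) ^ 2 ≤ a ^ (-(6 / 5) : ℝ) * b ^ (-(6 / 5) : ℝ) := by
  have young := rpow_mul_rpow_le_add_rpow (x := a ^ 2) (y := b ^ 2 / a) (p := 7 / 5) (q := 3 / 5)
    (by positivity) (by positivity) (by norm_num) (by norm_num)
  rw [show (7 / 5 + 3 / 5 : ℝ) = (2 : ℕ) by norm_num, Real.rpow_natCast] at young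
  have split_a : a = a ^ (-(6 / 5) : ℝ) * (a ^ 2) ^ (7 / 5 : ℝ) * a ^ (-(3 / 5) : ℝ) := by
    rw [← Real.rpow_natCast_mul ha.le, ← Real.rpow_add ha, ← Real.rpow_add ha]
    norm_num
  have split_b : 1 = b ^ (-(6 / 5) : ℝ) * (b ^ 2) ^ (3 / 5 : ℝ) := by
    rw [← Real.rpow_natCast_mul hb.le, ← Real.rpow_add hb]
    norm_num
  rw [div_le_iff₀ (by positivity)]
  calc a = a ^ (-(6 / 5) : ℝ) * (a ^ 2) ^ (7 / 5 : ℝ) * a ^ (-(3 / 5) : ℝ) *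
        (b ^ (-(6 / 5) : ℝ) * (b ^ 2) ^ (3 / 5 : ℝ)) := by rw [← split_a, ← split_b, mul_one]
    _ = a ^ (-(6 / 5) : ℝ) * b ^ (-(6 / 5) : ℝ) *
        ((a ^ 2) ^ (7 / 5 : ℝ) * (b ^ 2 / a) ^ (3 / 5 : ℝ)) := by
      rw [Real.div_rpow (sq_nonneg b) ha.le, Real.rpow_neg ha.le (3 / 5)]
      ring
    _ ≤ _ := by gcongr

lemma sq_add_max_sq_div_le_symbolL {n : Fin 2 → ℤ} (h : n 0 ≠ 0) :
    |(n 0 : ℝ)| ^ 2 + max 1 |(n 1 : ℝ)| ^ 2 / |(n 0 : ℝ)| ≤ symbolL n := by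
  have one_le : (1 : ℝ) ≤ |(n 0 : ℝ)| := mod_cast Int.one_le_abs h
  have max_sq_le : max 1 |(n 1 : ℝ)| ^ 2 ≤ 1 + |(n 1 : ℝ)| ^ 2 := by
    obtain hn | hn := max_choice 1 |(n 1 : ℝ)| <;> rw [hn] <;> nlinarith
  have inv_le : 1 / |(n 0 : ℝ)| ≤ |(n 0 : ℝ)| ^ 2 :=
    (div_le_one₀ (by positivity)).2 one_le |>.trans (one_le_pow₀ one_le)
  calc |(n 0 : ℝ)| ^ 2 + max 1 |(n 1 : ℝ)| ^ 2 / |(n 0 : ℝ)|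
      ≤ |(n 0 : ℝ)| ^ 2 + (1 / |(n 0 : ℝ)| + |(n 1 : ℝ)| ^ 2 / |(n 0 : ℝ)|) := by
        rw [← add_div]
        gcongr
    _ ≤ 2 * |(n 0 : ℝ)| ^ 2 + 1 * (|(n 1 : ℝ)| ^ 2 / |(n 0 : ℝ)|) := by linarith
    _ ≤ symbolL n := by
        rw [symbolL_eq]
        gcongr <;> nlinarith [Real.pi_gt_three]

lemma summable_max_one_abs_rpow {s : ℝ} (hs : s < -1) :
    Summable fun b : ℤ => max 1 |(b : ℝ)| ^ s := by
  refine (summable_congr_cofinite ?_).1 (Real.summable_abs_int_rpow (b := -s) (by linarith))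
  filter_upwards [(Set.finite_singleton (0 : ℤ)).compl_mem_cofinite] with b hb
  rw [neg_neg, max_eq_right (mod_cast Int.one_le_abs hb)]

lemma summable_abs_wave_mul_inv_symbolL_sq :
    Summable fun n : Fin 2 → ℤ => |wave n 0| * (symbolL n)⁻¹ ^ 2 := by
  have summable_weight := summable_max_one_abs_rpow (s := -(6 / 5)) (by norm_num)
  have summable_prod := (finTwoArrowEquiv ℤ).summable_iff.2
    (summable_weight.mul_of_nonneg summable_weight (fun _ => by positivity) fun _ => by positivity)
  refine (summable_prod.mul_left (2 * Real.pi)).of_nonneg_of_le (fun n => by positivity) fun n => ?_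
  obtain h | h := eq_or_ne (n 0) 0
  · rw [symbolL_eq_zero h, inv_zero, zero_pow two_ne_zero, mul_zero]
    simp only [Function.comp_apply]
    positivity
  have one_le : (1 : ℝ) ≤ |(n 0 : ℝ)| := mod_cast Int.one_le_abs h
  have hle := sq_add_max_sq_div_le_symbolL h
  calc |wave n 0| * (symbolL n)⁻¹ ^ 2
      = 2 * Real.pi * (|(n 0 : ℝ)| / symbolL n ^ 2) := by rw [abs_wave, inv_pow, mul_assoc]; rfl
    _ ≤ 2 * Real.pi * (|(n 0 : ℝ)| /
          (|(n 0 : ℝ)| ^ 2 + max 1 |(n 1 : ℝ)| ^ 2 / |(n 0 : ℝ)|) ^ 2) := by gcongr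
    _ ≤ 2 * Real.pi * (|(n 0 : ℝ)| ^ (-(6 / 5) : ℝ) * max 1 |(n 1 : ℝ)| ^ (-(6 / 5) : ℝ)) := by
        gcongr
        exact div_sq_add_sq_div_sq_le (by positivity) (by positivity)
    _ = _ := by
        rw [← max_eq_right one_le]
        simp [finTwoArrowEquiv]

lemma summable_inv_symbolL_sq : Summable fun n : Fin 2 → ℤ => (symbolL n)⁻¹ ^ 2 := by
  refine summable_abs_wave_mul_inv_symbolL_sq.of_nonneg_of_le (fun n => by positivity) fun n => ?_
  obtain h | h := eq_or_ne (n 0) 0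
  · simp [symbolL_eq_zero h]
  · have one_le : (1 : ℝ) ≤ |(n 0 : ℝ)| := mod_cast Int.one_le_abs h
    refine le_mul_of_one_le_left (by positivity) ?_
    rw [abs_wave]
    nlinarith [Real.pi_gt_three]

end Symbol

section Convolution

variable {G : Type*} [AddCommGroup G]

lemma tsum_tsum_mul_sub (f g : G → ℝ≥0∞) :
    ∑' k, ∑' m, f m * g (k - m) = (∑' m, f m) * ∑' m, g m := by
  rw [ENNReal.tsum_comm, ← ENNReal.tsum_mul_right]
  congr with m
  rw [ENNReal.tsum_mul_left]
  congr 1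
  exact (Equiv.subRight m).tsum_eq g

lemma tsum_mul_conv_le_of_subadditive {w : G → ℝ≥0∞} (hw : ∀ m n, w (m + n) ≤ w m + w n)
    (f : G → ℝ≥0∞) :
    ∑' k, w k * ∑' m, f m * f (k - m) ≤ 2 * ((∑' m, w m * f m) * ∑' m, f m) := by
  calc ∑' k, w k * ∑' m, f m * f (k - m)
      ≤ ∑' k, ∑' m, (w m * f m * f (k - m) + f m * (w (k - m) * f (k - m))) := by
        simp only [← ENNReal.tsum_mul_left]
        refine ENNReal.tsum_le_tsum fun k => ENNReal.tsum_le_tsum fun m => ?_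
        calc w k * (f m * f (k - m)) ≤ (w m + w (k - m)) * (f m * f (k - m)) := by
              gcongr
              simpa using hw m (k - m)
          _ = _ := by ring
    _ = 2 * ((∑' m, w m * f m) * ∑' m, f m) := by
        simp only [ENNReal.tsum_add]
        rw [tsum_tsum_mul_sub (fun m => w m * f m) f, tsum_tsum_mul_sub f fun m => w m * f m]
        ring

lemma tsum_wave_mul_conv_inv_symbolL_sq_ne_top :
    ∑' k : Fin 2 → ℤ, ‖wave k 0‖ₑ *
      ∑' m, ENNReal.ofReal (((symbolL m)⁻¹ * (symbolL (k - m))⁻¹) ^ 2) ≠ ⊤ := by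
  simp only [mul_pow, ENNReal.ofReal_mul (sq_nonneg (symbolL _)⁻¹)]
  refine ne_top_of_le_ne_top (ENNReal.mul_ne_top ENNReal.ofNat_ne_top (ENNReal.mul_ne_top ?_
    summable_inv_symbolL_sq.tsum_ofReal_ne_top))
    (tsum_mul_conv_le_of_subadditive (fun m n => by rw [wave_add]; exact enorm_add_le _ _) _)
  simpa only [ENNReal.ofReal_mul (abs_nonneg _), ← Real.enorm_eq_ofReal_abs] using
    summable_abs_wave_mul_inv_symbolL_sq.tsum_ofReal_ne_top

end Convolution

section Fourier

open UnitAddTorus (mFourier mFourierCoeff)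

lemma mFourierCoeff_congr_ae {f g : Torus → ℂ} (h : f =ᵐ[torusMeasure] g) :
    mFourierCoeff f = mFourierCoeff g :=
  funext fun _ => integral_congr_ae (μ := torusMeasure) (h.mono fun x hx => by simp only [hx])

lemma mFourierCoeff_star (f : Torus → ℂ) (n : Fin 2 → ℤ) :
    mFourierCoeff (star f) n = star (mFourierCoeff f (-n)) := by
  refine Eq.trans ?_ (integral_conj (𝕜 := ℂ))
  simp [mFourierCoeff, UnitAddTorus.mFourier_neg]

lemma mFourierCoeff_mFourier_mul (f : Torus → ℂ) (k n : Fin 2 → ℤ) :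
    mFourierCoeff (fun x => mFourier k x * f x) n = mFourierCoeff f (n - k) := by
  simp only [mFourierCoeff, smul_eq_mul, ← mul_assoc, ← UnitAddTorus.mFourier_add, neg_sub,
    neg_add_eq_sub]

lemma memLp_mFourier_mul {f : Torus → ℂ} {p : ℝ≥0∞} (hf : MemLp f p torusMeasure)
    (n : Fin 2 → ℤ) : MemLp (fun x => mFourier n x * f x) p torusMeasure := by
  refine hf.of_le ((mFourier n).continuous.aestronglyMeasurable.mul hf.aestronglyMeasurable)
    (.of_forall fun x => ?_)
  rw [norm_mul]
  exact mul_le_of_le_one_left (norm_nonneg _)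
    (((mFourier n).norm_coe_le_norm x).trans UnitAddTorus.mFourier_norm.le)

/-- The Fourier basis of `L²(𝕋²)`, for the measure `torusMeasure`. -/
def torusBasis : HilbertBasis (Fin 2 → ℤ) ℂ (Lp ℂ 2 torusMeasure) :=
  UnitAddTorus.mFourierBasis

lemma torusBasis_repr (f : Lp ℂ 2 torusMeasure) (n : Fin 2 → ℤ) :
    torusBasis.repr f n = mFourierCoeff f n :=
  UnitAddTorus.mFourierBasis_repr f n

lemma ae_eq_of_mFourierCoeff_eq {f g : Torus → ℂ} (hf : MemLp f 2 torusMeasure)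
    (hg : MemLp g 2 torusMeasure) (h : ∀ n, mFourierCoeff f n = mFourierCoeff g n) :
    f =ᵐ[torusMeasure] g := by
  refine (MemLp.toLp_eq_toLp_iff hf hg).1 (torusBasis.repr.injective ?_)
  ext n
  rw [torusBasis_repr, torusBasis_repr, mFourierCoeff_congr_ae hf.coeFn_toLp,
    mFourierCoeff_congr_ae hg.coeFn_toLp, h]

lemma hasSum_star_mFourierCoeff_mul (f g : Lp ℂ 2 torusMeasure) :
    HasSum (fun n => star (mFourierCoeff f n) * mFourierCoeff g n)
      (∫ x, star (f x) * g x ∂torusMeasure) :=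
  UnitAddTorus.hasSum_prod_mFourierCoeff f g

lemma hasSum_mFourierCoeff_mul {f g : Torus → ℂ} (hf : MemLp f 2 torusMeasure)
    (hg : MemLp g 2 torusMeasure) (k : Fin 2 → ℤ) :
    HasSum (fun m => mFourierCoeff f m * mFourierCoeff g (k - m))
      (mFourierCoeff (fun x => f x * g x) k) := by
  have hg' := memLp_mFourier_mul hg.star k
  have parseval := hasSum_star_mFourierCoeff_mul (hg'.toLp _) (hf.toLp _)
  simp only [mFourierCoeff_congr_ae hg'.coeFn_toLp, mFourierCoeff_congr_ae hf.coeFn_toLp,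
    mFourierCoeff_mFourier_mul, mFourierCoeff_star, neg_sub] at parseval
  convert parseval using 1
  · ext m
    simp [mul_comm]
  · refine integral_congr_ae (μ := torusMeasure) ?_
    filter_upwards [hg'.coeFn_toLp, hf.coeFn_toLp] with x hgx hfx
    rw [hgx, hfx]
    simp only [UnitAddTorus.mFourier_neg, Pi.star_apply, starRingEnd_apply, star_mul, star_star,
      smul_eq_mul]
    ring

lemma eq_of_coeff_eq {u v : Lp ℝ 2 torusMeasure} (h : ∀ n, coeff u n = coeff v n) : u = v := by
  refine Lp.ext ?_
  filter_upwards [ae_eq_of_mFourierCoeff_eq (Lp.memLp u).ofReal (Lp.memLp v).ofReal h] with x hx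
  exact Complex.ofReal_injective hx

lemma exists_Lp_coeff_eq {c : (Fin 2 → ℤ) → ℂ} (hs : Summable fun n => ‖c n‖ ^ 2)
    (hc : ∀ n, c (-n) = star (c n)) : ∃ v : Lp ℝ 2 torusMeasure, ∀ n, coeff v n = c n := by
  have mem_l2 : Memℓp c 2 := memℓp_gen (by simpa using hs)
  set U : Lp ℂ 2 torusMeasure := torusBasis.repr.symm ⟨c, mem_l2⟩ with hU
  have coeff_U (n) : mFourierCoeff U n = c n := by
    rw [← torusBasis_repr, hU, LinearIsometryEquiv.apply_symm_apply]
  have real_U : star (U : Torus → ℂ) =ᵐ[torusMeasure] U :=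
    ae_eq_of_mFourierCoeff_eq (Lp.memLp U).star (Lp.memLp U) fun n => by
      rw [mFourierCoeff_star, coeff_U, coeff_U, hc, star_star]
  refine ⟨(Lp.memLp U).re.toLp _, fun n => ?_⟩
  rw [← coeff_U n, coeff]
  refine congrFun (mFourierCoeff_congr_ae ?_) n
  filter_upwards [(Lp.memLp U).re.coeFn_toLp, real_U] with x re_eq star_eq
  rw [re_eq]
  exact Complex.conj_eq_iff_re.1 star_eq

lemma hasSum_coeff_mul_coeff (v : Lp ℝ 2 torusMeasure) (k : Fin 2 → ℤ) :
    HasSum (fun m => coeff v m * coeff v (k - m)) (2 * coeff (halfSq v) k) := by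
  have two_mul_coeff :
      2 * coeff (halfSq v) k = mFourierCoeff (fun x => (v x : ℂ) * (v x : ℂ)) k := by
    refine (integral_const_mul (μ := torusMeasure) (L := ℂ) _ _).symm.trans ?_
    refine integral_congr_ae (μ := torusMeasure) (.of_forall fun x => ?_)
    simp only [halfSq, smul_eq_mul]
    push_cast
    ring
  rw [two_mul_coeff]
  exact hasSum_mFourierCoeff_mul (Lp.memLp v).ofReal (Lp.memLp v).ofReal k

end Fourier

section LinearSolution

variable {ξ : PeriodicDistribution}

lemma isLinearSolution_iff {v : Torus → ℝ} :
    IsLinearSolution ξ v ↔ ∀ n, coeff v n = ((symbolL n)⁻¹ : ℝ) * ξ.coeff n := by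
  have symbol_ne_zero {n : Fin 2 → ℤ} (hn : n 0 ≠ 0) : (symbolL n : ℂ) ≠ 0 :=
    Complex.ofReal_ne_zero.2 (symbolL_pos hn).ne'
  refine ⟨fun h n => ?_, fun h => ⟨fun n hn => ?_, fun n hn => ?_⟩⟩
  · obtain hn | hn := eq_or_ne (n 0) 0
    · rw [h.zero_average n hn, symbolL_eq_zero hn, inv_zero, Complex.ofReal_zero, zero_mul]
    · rw [← h.equation n hn, Complex.ofReal_inv, inv_mul_cancel_left₀ (symbol_ne_zero hn)]
  · rw [h, symbolL_eq_zero hn, inv_zero, Complex.ofReal_zero, zero_mul]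
  · rw [h, Complex.ofReal_inv, mul_inv_cancel_left₀ (symbol_ne_zero hn)]

lemma existsUnique_isLinearSolution
    (hs : Summable fun n => (symbolL n)⁻¹ ^ 2 * ‖ξ.coeff n‖ ^ 2) :
    ∃! v : Lp ℝ 2 torusMeasure, IsLinearSolution ξ v := by
  obtain ⟨v, hv⟩ := exists_Lp_coeff_eq (c := fun n => ((symbolL n)⁻¹ : ℝ) * ξ.coeff n)
    (hs.congr fun n => by rw [norm_mul, mul_pow, Complex.norm_real, Real.norm_eq_abs, sq_abs])
    (fun n => by rw [symbolL_neg, ξ.coeff_neg, star_mul', Complex.star_def, Complex.conj_ofReal])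
  refine ⟨v, isLinearSolution_iff.2 hv, fun u hu => eq_of_coeff_eq fun n => ?_⟩
  rw [hv, isLinearSolution_iff.1 hu]

lemma norm_halfInv_sq (n : Fin 2 → ℤ) : ‖halfInv n‖ ^ 2 = |wave n 0|⁻¹ := by
  rw [halfInv, Complex.norm_real, Real.norm_eq_abs, sq_abs,
    ← Real.rpow_mul_natCast (abs_nonneg _), ← Real.rpow_neg_one]
  norm_num

lemma norm_coeffD1_sq (u : Torus → ℝ) (n : Fin 2 → ℤ) :
    ‖coeffD1 u n‖ ^ 2 = wave n 0 ^ 2 * ‖coeff u n‖ ^ 2 := by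
  simp [coeffD1, mul_pow]

lemma norm_coeffD2_sq (u : Torus → ℝ) (n : Fin 2 → ℤ) :
    ‖coeffD2 u n‖ ^ 2 = wave n 1 ^ 2 * ‖coeff u n‖ ^ 2 := by
  simp [coeffD2, mul_pow]

lemma norm_halfInv_mul_coeffD1_sq (u : Torus → ℝ) (n : Fin 2 → ℤ) :
    ‖halfInv n * coeffD1 u n‖ ^ 2 = |wave n 0| * ‖coeff u n‖ ^ 2 := by
  rw [norm_mul, mul_pow, norm_halfInv_sq, norm_coeffD1_sq, ← sq_abs (wave n 0), ← mul_assoc, sq,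
    ← mul_assoc, inv_mul_mul_self]

lemma norm_coeffD1_sq_add_norm_halfInv_mul_coeffD2_sq (u : Torus → ℝ) (n : Fin 2 → ℤ) :
    ‖coeffD1 u n‖ ^ 2 + ‖halfInv n * coeffD2 u n‖ ^ 2 = symbolL n * ‖coeff u n‖ ^ 2 := by
  rw [norm_mul, mul_pow, norm_halfInv_sq, norm_coeffD1_sq, norm_coeffD2_sq, ← mul_assoc,
    ← add_mul, ← symbolL]

lemma tsum_subtype_div_symbolL (ξ : PeriodicDistribution) :
    ∑' n : {n : Fin 2 → ℤ // n 0 ≠ 0}, ENNReal.ofReal (‖ξ.coeff n.1‖ ^ 2 / symbolL n.1) =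
      ∑' n, ENNReal.ofReal ((symbolL n)⁻¹ * ‖ξ.coeff n‖ ^ 2) := by
  simp only [div_eq_inv_mul]
  refine tsum_subtype_eq_of_support_subset (s := {n : Fin 2 → ℤ | n 0 ≠ 0})
    (f := fun n => ENNReal.ofReal ((symbolL n)⁻¹ * ‖ξ.coeff n‖ ^ 2)) fun n hn h0 => hn ?_
  simp [symbolL_eq_zero h0]

namespace IsLinearSolution

lemma symbolL_mul_norm_coeff_sq {v : Torus → ℝ} (hv : IsLinearSolution ξ v) (n : Fin 2 → ℤ) :
    symbolL n * ‖coeff v n‖ ^ 2 = (symbolL n)⁻¹ * ‖ξ.coeff n‖ ^ 2 := by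
  have cancel : symbolL n * (symbolL n)⁻¹ ^ 2 = (symbolL n)⁻¹ := by
    rw [mul_comm, sq]
    simpa only [inv_inv] using mul_self_mul_inv (symbolL n)⁻¹
  rw [isLinearSolution_iff.1 hv, norm_mul, mul_pow, Complex.norm_real, Real.norm_eq_abs, sq_abs,
    ← mul_assoc, cancel]

lemma harmonicEnergy_eq {v : Torus → ℝ} (hv : IsLinearSolution ξ v) :
    harmonicEnergy v = ∑' n, ENNReal.ofReal ((symbolL n)⁻¹ * ‖ξ.coeff n‖ ^ 2) := by
  rw [harmonicEnergy, ← ENNReal.tsum_add]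
  congr with n
  rw [← ENNReal.ofReal_add (sq_nonneg _) (sq_nonneg _),
    norm_coeffD1_sq_add_norm_halfInv_mul_coeffD2_sq, hv.symbolL_mul_norm_coeff_sq]

lemma re_coeff_mul_conj {v : Torus → ℝ} (hv : IsLinearSolution ξ v) (n : Fin 2 → ℤ) :
    (ξ.coeff n * (starRingEnd ℂ) (coeff v n)).re = (symbolL n)⁻¹ * ‖ξ.coeff n‖ ^ 2 := by
  rw [isLinearSolution_iff.1 hv, map_mul, Complex.conj_ofReal, mul_left_comm, Complex.mul_conj,
    Complex.normSq_eq_norm_sq, ← Complex.ofReal_mul, Complex.ofReal_re]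

lemma quarticEnergy_le {v : Lp ℝ 2 torusMeasure} (hv : IsLinearSolution ξ v) :
    quarticEnergy v ≤ ∑' k, ‖wave k 0‖ₑ * ‖∑' m, ((symbolL m)⁻¹ : ℝ) * ξ.coeff m *
      (((symbolL (k - m))⁻¹ : ℝ) * ξ.coeff (k - m))‖ₑ ^ 2 := by
  refine ENNReal.tsum_le_tsum fun k => ?_
  simp only [← isLinearSolution_iff.1 hv]
  rw [(hasSum_coeff_mul_coeff v k).tsum_eq, norm_halfInv_mul_coeffD1_sq,
    ENNReal.ofReal_mul (abs_nonneg _), ← Real.enorm_eq_ofReal_abs,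
    ENNReal.ofReal_pow (norm_nonneg _), ofReal_norm, enorm_mul]
  gcongr
  refine le_mul_of_one_le_left zero_le ?_
  rw [← ofReal_norm, Complex.norm_ofNat, ENNReal.ofReal_ofNat]
  exact one_le_two

/-- The linear term contributes `-2 h` against the harmonic energy `h`, and Young's inequality
absorbs the mixed term of the square at the cost of `h / 2`. -/
lemma totalEnergyMode_le {v : Torus → ℝ} (hv : IsLinearSolution ξ v) (n : Fin 2 → ℤ) :
    totalEnergyMode ξ v n ≤ 3 * ‖halfInv n * coeffD1 (halfSq v) n‖ ^ 2 -
      1 / 2 * ((symbolL n)⁻¹ * ‖ξ.coeff n‖ ^ 2) := by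
  have energy_eq := norm_coeffD1_sq_add_norm_halfInv_mul_coeffD2_sq v n
  rw [hv.symbolL_mul_norm_coeff_sq] at energy_eq
  rw [totalEnergyMode, hv.re_coeff_mul_conj, mul_sub]
  have norm_sub_sq_le := pow_le_pow_left₀ (norm_nonneg _)
    (norm_sub_le (halfInv n * coeffD2 v n) (halfInv n * coeffD1 (halfSq v) n)) 2
  nlinarith [sq_nonneg (‖halfInv n * coeffD2 v n‖ - 2 * ‖halfInv n * coeffD1 (halfSq v) n‖),
    sq_nonneg ‖coeffD1 v n‖]

end IsLinearSolution

lemma hasSum_coe_bot {ι : Type*} {e q h : ι → ℝ} (hle : ∀ n, e n ≤ q n - h n) (hq : Summable q)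
    (hh : ∀ n, 0 ≤ h n) (hns : ¬ Summable h) : HasSum (fun n => (e n : EReal)) ⊥ := by
  have sum_atBot : Tendsto (fun F : Finset ι => ∑ n ∈ F, e n) atTop atBot := by
    refine tendsto_atBot_mono (fun F => Finset.sum_le_sum fun n _ => hle n) ?_
    simp only [sub_eq_add_neg, Finset.sum_add_distrib, Finset.sum_neg_distrib]
    exact hq.hasSum.add_atBot
      (tendsto_neg_atTop_atBot.comp (tendsto_sum_atTop_of_not_summable hh hns))
  refine (EReal.tendsto_coe_nhds_bot_iff.2 sum_atBot).congr fun F => ?_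
  exact map_sum (⟨⟨Real.toEReal, EReal.coe_zero⟩, EReal.coe_add⟩ : ℝ →+ EReal) e F

lemma IsLinearSolution.hasSum_totalEnergyMode_bot {v : Torus → ℝ} (hv : IsLinearSolution ξ v)
    (hH : harmonicEnergy v = ⊤) (hQ : quarticEnergy v < ⊤) :
    HasSum (fun n => (totalEnergyMode ξ v n : EReal)) ⊥ := by
  have summable_quartic : Summable fun n => ‖halfInv n * coeffD1 (halfSq v) n‖ ^ 2 :=
    (ENNReal.summable_toReal hQ.ne).congr fun n => ENNReal.toReal_ofReal (sq_nonneg _)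
  refine hasSum_coe_bot hv.totalEnergyMode_le (summable_quartic.mul_left 3)
    (fun n => mul_nonneg one_half_pos.le
      (mul_nonneg (inv_nonneg.2 (symbolL_nonneg n)) (sq_nonneg _))) ?_
  rw [summable_mul_left_iff one_half_pos.ne']
  exact fun h => h.tsum_ofReal_ne_top (hv.harmonicEnergy_eq.symm.trans hH)

end LinearSolution

end Ripple

end

theorem mainTheorem11 (μ : Measure Ripple.PeriodicDistribution) (hμ : Ripple.IsWhiteNoise μ) :
    ∀ᵐ ξ ∂μ,
      (∃! v : Lp ℝ 2 Ripple.torusMeasure, Ripple.IsLinearSolution ξ v) ∧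
      ∀ v : Lp ℝ 2 Ripple.torusMeasure, Ripple.IsLinearSolution ξ v →
        Ripple.harmonicEnergy v =
            ∑' n : {n : Fin 2 → ℤ // n 0 ≠ 0},
              ENNReal.ofReal (‖ξ.coeff n.1‖ ^ 2 / Ripple.symbolL n.1) ∧
        Ripple.harmonicEnergy v = ⊤ ∧
        Ripple.quarticEnergy v < ⊤ ∧
        HasSum (fun n : Fin 2 → ℤ => (Ripple.totalEnergyMode ξ v n : EReal)) ⊥ ∧
        Ripple.totalEnergy ξ v = ⊥ := by
  have := hμ.isProbabilityMeasure
  have moments := hμ.hasWhiteNoiseMoments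
  filter_upwards [
    moments.ae_summable_mul_norm_sq (fun n => sq_nonneg _) Ripple.summable_inv_symbolL_sq,
    moments.ae_tsum_mul_norm_sq_eq_top (fun n => inv_nonneg.2 (Ripple.symbolL_nonneg n))
      Ripple.not_summable_inv_symbolL Ripple.summable_inv_symbolL_sq,
    moments.ae_tsum_mul_enorm_conv_sq_lt_top Ripple.summable_inv_symbolL_sq
      (w := fun k => ‖Ripple.wave k 0‖ₑ) (by simp [Ripple.wave])
      Ripple.tsum_wave_mul_conv_inv_symbolL_sq_ne_top]
    with ξ summable_sol harmonic_eq_top quartic_lt_top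
  refine ⟨Ripple.existsUnique_isLinearSolution summable_sol, fun v hv => ?_⟩
  have hH := hv.harmonicEnergy_eq.trans harmonic_eq_top
  have hQ := hv.quarticEnergy_le.trans_lt quartic_lt_top
  have hE := hv.hasSum_totalEnergyMode_bot hH hQ
  exact ⟨hv.harmonicEnergy_eq.trans (Ripple.tsum_subtype_div_symbolL ξ).symm, hH, hQ, hE,
    hE.tsum_eq⟩
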